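/- Let $T\ge 2$ and $m\ge 1$ be integers and let $c_1<\dots<c_m$ be elements of $\{1,\dots,T-1\}$, the change points. Let $\mathbf X_1,\dots,\mathbf X_{m+1}$ be independent sequences $\mathbf X_v=(X_{v,i})_{i\ge1}$, each consisting of i.i.d. real random variables with $E|X_{v,1}|^4<\infty$ and positive variance. Write $\mu_v=E[X_{v,1}]$, $\sigma_v^2=\mathrm{Var}(X_{v,1})>0$, $\mu_v^{\{3\}}=E[(X_{v,1}-\mu_v)^3]$ and $\nu_v^2=\mathrm{Var}((X_{v,1}-\mu_v)^2)$, and assume $(\mu_v,\sigma_v^2)\ne(\mu_{v+1},\sigma_{v+1}^2)$ for $v=1,\dots,m$. For $n\in\mathbb N$ let $X_i=X_{1,i}$ for $i\le nc_1$, $X_i=X_{v,i}$ for $nc_{v-1}<i\le nc_v$ ($2\le v\le m$), and $X_i=X_{m+1,i}$ for $nc_m<i\le nT$ (the dependence of $X_i$ on $n$ is suppressed). Let $h\in\{2,\dots,\lfloor T/2\rfloor\}$ be a window size, and let $c=c_u$ be a change point with $h\le c\le T-h$ such that $(c-h,c+h]\setminus\{c\}$ contains no change point. Assume that $\nu_u^2+\nu_{u+1}^2>0$.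 Put $I_\ell=\{n(c-h)+1,\dots,nc\}$ and $I_r=\{nc+1,\dots,n(c+h)\}$, and for $j\in\{\ell,r\}$ $$\hat\mu_j=\frac1{nh}\sum_{i\in I_j}X_i,\qquad \hat\sigma_j^2=\frac1{nh}\sum_{i\in I_j}(X_i-\hat\mu_j)^2,\qquad \hat\nu_j^2=\frac1{nh}\sum_{i\in I_j}(X_i-\hat\mu_j)^4-(\hat\sigma_j^2)^2.$$ Let $$J_{h,c}^{(n)}=\begin{pmatrix}\dfrac{\hat\mu_r-\hat\mu_\ell}{[(\hat\sigma_r^2+\hat\sigma_\ell^2)/(nh)]^{1/2}}\\[2ex]\dfrac{\hat\sigma_r^2-\hat\sigma_\ell^2}{[(\hat\nu_r^2+\hat\nu_\ell^2)/(nh)]^{1/2}}\end{pmatrix},\qquad j_{h,c}^{(n)}=\begin{pmatrix}\dfrac{\mu_{u+1}-\mu_u}{[(\sigma_{u+1}^2+\sigma_u^2)/(nh)]^{1/2}}\\[2ex]\dfrac{\sigma_{u+1}^2-\sigma_u^2}{[(\nu_{u+1}^2+\nu_u^2)/(nh)]^{1/2}}\end{pmatrix},$$ $$\Delta_{h,c}^{(n)}=\begin{pmatrix}\left(\dfrac{\sigma_{u+1}^2+\sigma_u^2}{\hat\sigma_r^2+\hat\sigma_\ell^2}\right)^{1/2}&0\\0&\left(\dfrac{\nu_{u+1}^2+\nu_u^2}{\hat\nu_r^2+\hat\nu_\ell^2}\right)^{1/2}\end{pmatrix},$$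 where a quotient with denominator $0$ is read as $0$ (this happens with probability tending to $0$). Let $$\Gamma_c=\begin{pmatrix}1&\rho_c\\\rho_c&1\end{pmatrix},\qquad \rho_c=\frac{\mu_{u+1}^{\{3\}}+\mu_u^{\{3\}}}{\sqrt{\sigma_{u+1}^2+\sigma_u^2}\,\sqrt{\nu_{u+1}^2+\nu_u^2}}.$$ Then $\Gamma_c$ is positive semidefinite, and as $n\to\infty$ $$J_{h,c}^{(n)}-\Delta_{h,c}^{(n)}\,j_{h,c}^{(n)}\ \longrightarrow\ N_2(0,\Gamma_c)\quad\text{in distribution},$$ where $N_2(0,\Gamma_c)$ is the (possibly degenerate) bivariate normal distribution with mean $0$ and covariance matrix $\Gamma_c$. -/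

import Mathlib

open MeasureTheory ProbabilityTheory Filter
open scoped Matrix

namespace ChangePoint

noncomputable section

/-! ### Auxiliary processes and their population parameters

A process is a sequence `Y : ℕ → Ω → ℝ`, of which only the entries `Y 1, Y 2, …` are used;
`Y 0` carries no information and nothing is assumed about it. -/

/-- `Y 1, Y 2, …` are i.i.d. real random variables with a finite fourth moment and a positive
variance. -/
structure IsAuxiliaryProcess {Ω : Type*} [MeasurableSpace Ω] (P : Measure Ω)
    (Y : ℕ → Ω → ℝ) : Prop where
  measurable : ∀ i, 1 ≤ i → Measurable (Y i)
  indep : iIndepFun (fun i : ℕ => Y (i + 1)) P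
  ident : ∀ i, 1 ≤ i → IdentDistrib (Y i) (Y 1) P P
  fourth_moment : Integrable (fun ω => |Y 1 ω| ^ 4) P
  variance_pos : 0 < Var[Y 1; P]

section Parameters

variable {Ω : Type*} [MeasurableSpace Ω] (P : Measure Ω) (Y : ℕ → Ω → ℝ)

/-- The expectation `μ`. -/
def popMean : ℝ := ∫ ω, Y 1 ω ∂P

/-- The `k`-th centered moment `μ^{k}`. -/
def popCenteredMoment (k : ℕ) : ℝ := ∫ ω, (Y 1 ω - popMean P Y) ^ k ∂P

/-- The variance `σ²`. -/
def popVar : ℝ := Var[Y 1; P]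

/-- `ν²`, the variance of `(Y 1 - μ)²`. -/
def popNuSq : ℝ := Var[fun ω => (Y 1 ω - popMean P Y) ^ 2; P]

end Parameters

/-! ### The model with change points -/

/-- The segment (counted from `0`) to which index `i` belongs when the change points are
`n * c 0 < n * c 1 < …`: the number of change points strictly before `i`. -/
def segment {m : ℕ} (c : Fin m → ℕ) (n i : ℕ) : Fin (m + 1) :=
  ⟨(Finset.univ.filter fun v => n * c v < i).card, by
    have h := Finset.card_filter_le (Finset.univ : Finset (Fin m)) fun v => n * c v < i
    rw [Finset.card_univ, Fintype.card_fin] at h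
    omega⟩

/-- The compound process at stage `n`: its `i`-th entry is the `i`-th entry of the auxiliary
process that governs the segment of `i`. -/
def compound {Ω : Type*} {m : ℕ} (c : Fin m → ℕ) (X : Fin (m + 1) → ℕ → Ω → ℝ)
    (n i : ℕ) (ω : Ω) : ℝ :=
  X (segment c n i) i ω

/-- The model: change points `c 0 < ⋯ < c (m - 1)` in `{1, …, T - 1}` and `m + 1` independent
auxiliary processes such that mean or variance (or both) change at each change point. -/
structure IsModel {Ω : Type*} [MeasurableSpace Ω] (P : Measure Ω) (T : ℕ) {m : ℕ}
    (c : Fin m → ℕ) (X : Fin (m + 1) → ℕ → Ω → ℝ) : Prop where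
  two_le_T : 2 ≤ T
  strictMono : StrictMono c
  mem_Icc : ∀ v, c v ∈ Finset.Icc 1 (T - 1)
  auxiliary : ∀ u, IsAuxiliaryProcess P (X u)
  indep : iIndepFun (fun (u : Fin (m + 1)) (ω : Ω) (i : ℕ) => X u (i + 1) ω) P
  change : ∀ v : Fin m,
    (popMean P (X v.castSucc), popVar P (X v.castSucc)) ≠
      (popMean P (X v.succ), popVar P (X v.succ))

/-! ### Local estimators and the joint statistic

Here `x : ℕ → ℝ` is a realization, `h` the window size, `n` the stage, `t` the time point. -/

/-- Indices of the left window. -/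
def leftWindow (h n : ℕ) (t : ℝ) : Finset ℕ := Finset.Ioc ⌊(n : ℝ) * (t - h)⌋₊ ⌊(n : ℝ) * t⌋₊

/-- Indices of the right window. -/
def rightWindow (h n : ℕ) (t : ℝ) : Finset ℕ := Finset.Ioc ⌊(n : ℝ) * t⌋₊ ⌊(n : ℝ) * (t + h)⌋₊

/-- Empirical `k`-th moment over the index set `I`, normalized by `n h`. -/
def empMoment (h n : ℕ) (I : Finset ℕ) (k : ℕ) (x : ℕ → ℝ) : ℝ :=
  (1 / ((n : ℝ) * h)) * ∑ i ∈ I, x i ^ k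

/-- Empirical mean `μ̂`. -/
def empMean (h n : ℕ) (I : Finset ℕ) (x : ℕ → ℝ) : ℝ := empMoment h n I 1 x

/-- Empirical `k`-th centered moment over the index set `I`, normalized by `n h`. -/
def empCenteredMoment (h n : ℕ) (I : Finset ℕ) (k : ℕ) (x : ℕ → ℝ) : ℝ :=
  (1 / ((n : ℝ) * h)) * ∑ i ∈ I, (x i - empMean h n I x) ^ k

/-- Empirical variance `σ̂²`. -/
def empVar (h n : ℕ) (I : Finset ℕ) (x : ℕ → ℝ) : ℝ := empCenteredMoment h n I 2 x

/-- The estimator `ν̂²` of `ν²`. -/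
def empNuSq (h n : ℕ) (I : Finset ℕ) (x : ℕ → ℝ) : ℝ :=
  empCenteredMoment h n I 4 x - empVar h n I x ^ 2

/-- `E_{h,t}^{(n)}`, the studentized difference of local means. -/
def statE (h n : ℕ) (t : ℝ) (x : ℕ → ℝ) : ℝ :=
  (empMean h n (rightWindow h n t) x - empMean h n (leftWindow h n t) x) /
    √((empVar h n (rightWindow h n t) x + empVar h n (leftWindow h n t) x) / ((n : ℝ) * h))

/-- `V_{h,t}^{(n)}`, the studentized difference of local variances. -/
def statV (h n : ℕ) (t : ℝ) (x : ℕ → ℝ) : ℝ :=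
  (empVar h n (rightWindow h n t) x - empVar h n (leftWindow h n t) x) /
    √((empNuSq h n (rightWindow h n t) x + empNuSq h n (leftWindow h n t) x) / ((n : ℝ) * h))

/-- The joint statistic `J_{h,t}^{(n)} = (E_{h,t}^{(n)}, V_{h,t}^{(n)})`. -/
def statJ (h n : ℕ) (t : ℝ) (x : ℕ → ℝ) : Fin 2 → ℝ := ![statE h n t x, statV h n t x]

/-! ### Centering, scaling and limit covariance at a change point

`Y₁` and `Y₂` are the auxiliary processes left and right of the change point. -/

section AtChange

variable {Ω : Type*} [MeasurableSpace Ω] (P : Measure Ω) (Y₁ Y₂ : ℕ → Ω → ℝ)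

/-- The centering vector `j_{h,c}^{(n)}`. -/
def centering (h n : ℕ) : Fin 2 → ℝ :=
  ![(popMean P Y₂ - popMean P Y₁) / √((popVar P Y₂ + popVar P Y₁) / ((n : ℝ) * h)),
    (popVar P Y₂ - popVar P Y₁) / √((popNuSq P Y₂ + popNuSq P Y₁) / ((n : ℝ) * h))]

/-- The random diagonal matrix `Δ_{h,c}^{(n)}` at time `t = c`. -/
def scaling (h n : ℕ) (t : ℝ) (x : ℕ → ℝ) : Matrix (Fin 2) (Fin 2) ℝ :=
  !![√((popVar P Y₂ + popVar P Y₁) /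
        (empVar h n (rightWindow h n t) x + empVar h n (leftWindow h n t) x)), 0;
     0, √((popNuSq P Y₂ + popNuSq P Y₁) /
        (empNuSq h n (rightWindow h n t) x + empNuSq h n (leftWindow h n t) x))]

/-- The asymptotic correlation `ρ_c`. -/
def rhoC : ℝ :=
  (popCenteredMoment P Y₂ 3 + popCenteredMoment P Y₁ 3) /
    (√(popVar P Y₂ + popVar P Y₁) * √(popNuSq P Y₂ + popNuSq P Y₁))

/-- The asymptotic correlation matrix `Γ_c`. -/
def gammaC : Matrix (Fin 2) (Fin 2) ℝ := !![1, rhoC P Y₁ Y₂; rhoC P Y₁ Y₂, 1]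

end AtChange

end

end ChangePoint

open ChangePoint

/-!
Write `A = Y - μ` and `B = Z - μ'` for the centered processes on the left and on the right of the
change point, `N = n h` for the length of a window, and `a_k`, `b_k` for the averages of `A ^ k` and
`B ^ k` over the left and the right window. Up to its random normalization, the centered statistic
has the coordinates `√N (b₁ - a₁)` and
`√N ((b₂ - σ'²) - (a₂ - σ²)) - √N (b₁² - a₁²)`, the last term being the price of centering at the
empirical means. It equals `√N (b₁ - a₁) · (b₁ + a₁)`, that is, the first coordinate times a
sequence that tends to `0`. Hence the centered statistic is a continuous function
(`applyCorrection`) of a vector that depends linearly on the window averages (`normalizedDiff`) and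
of random coefficients (`correction`); see `statJ_sub_scaling_mulVec_centering`.

The coefficients converge almost surely to constants: by the strong law of large numbers all window
averages converge, because a window sum is a difference of two partial sums
(`IsAuxiliaryProcess.ae_tendsto_winMoment`), and the estimators are polynomials in these averages.
The vector converges to the normal distribution by Lévy's theorem
(`tendstoInDistribution_normalizedDiff`): each of its linear functionals is a sum of two independent
normalized block sums of i.i.d. variables, one for each window, to which the one-dimensional central
limit theorem applies (`tendsto_charFun_blockSum`), and the two limit variances add up to the
quadratic form of `Γ` (`dotProduct_gammaC_mulVec`), which is therefore positive semidefinite.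
Slutsky's theorem combines the two limits.
-/

namespace ChangePoint

noncomputable section

/-! ### Windows and empirical moments of a realization -/

/-- The `k`-th empirical moment of `x - μ` over the `n h` indices that follow `n a`.
Unlike in `empCenteredMoment`, the centering `μ` is a given number, not the empirical mean. -/
def winMoment (h n a k : ℕ) (μ : ℝ) (x : ℕ → ℝ) : ℝ :=
  empMoment h n (Finset.Ioc (n * a) (n * (a + h))) k fun i => x i - μ

lemma sum_Ioc_eq_sum_range {M : Type*} [AddCommMonoid M] (f : ℕ → M) (a N : ℕ) :
    ∑ i ∈ Finset.Ioc a (a + N), f i = ∑ k ∈ Finset.range N, f (a + k + 1) := by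
  induction N with
  | zero => simp
  | succ N ih =>
    rw [← add_assoc, Finset.sum_Ioc_succ_top (by omega), ih, Finset.sum_range_succ]

lemma winMoment_eq_sum_range (h n a k : ℕ) (μ : ℝ) (x : ℕ → ℝ) :
    winMoment h n a k μ x =
      ((n * h : ℕ) : ℝ)⁻¹ * ∑ j ∈ Finset.range (n * h), (x (n * a + j + 1) - μ) ^ k := by
  rw [winMoment, empMoment, mul_add, sum_Ioc_eq_sum_range (fun i => (x i - μ) ^ k), one_div,
    Nat.cast_mul]

lemma empMoment_congr (h n k : ℕ) {I : Finset ℕ} {x y : ℕ → ℝ} (hxy : ∀ i ∈ I, x i = y i) :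
    empMoment h n I k x = empMoment h n I k y := by
  unfold empMoment
  rw [Finset.sum_congr rfl fun i hi => by rw [hxy i hi]]

lemma empCenteredMoment_congr (h n k : ℕ) {I : Finset ℕ} {x y : ℕ → ℝ}
    (hxy : ∀ i ∈ I, x i = y i) :
    empCenteredMoment h n I k x = empCenteredMoment h n I k y := by
  unfold empCenteredMoment empMean
  rw [Finset.sum_congr rfl fun i hi => by rw [hxy i hi, empMoment_congr h n 1 hxy]]

section Estimators

variable {h n : ℕ} (a : ℕ) (μ : ℝ) (x : ℕ → ℝ)

lemma sum_pow_eq_winMoment (hN : 0 < n * h) (k : ℕ) :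
    ∑ i ∈ Finset.Ioc (n * a) (n * (a + h)), (x i - μ) ^ k =
      (n * h : ℝ) * winMoment h n a k μ x := by
  have hN' : (n * h : ℝ) ≠ 0 := by exact_mod_cast hN.ne'
  rw [winMoment, empMoment, one_div, mul_inv_cancel_left₀ hN']

lemma card_window (h n a : ℕ) : (Finset.Ioc (n * a) (n * (a + h))).card = n * h := by
  simp [mul_add]

lemma empMean_eq_winMoment (hN : 0 < n * h) :
    empMean h n (Finset.Ioc (n * a) (n * (a + h))) x = μ + winMoment h n a 1 μ x := by
  have hN' : (n * h : ℝ) ≠ 0 := by exact_mod_cast hN.ne'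
  have hs := sum_pow_eq_winMoment a μ x hN 1
  simp only [pow_one, Finset.sum_sub_distrib, Finset.sum_const, card_window,
    nsmul_eq_mul, Nat.cast_mul] at hs
  simp only [empMean, empMoment, pow_one]
  rw [one_div, inv_mul_eq_iff_eq_mul₀ hN']
  linarith

lemma empVar_eq_winMoment (hN : 0 < n * h) :
    empVar h n (Finset.Ioc (n * a) (n * (a + h))) x =
      winMoment h n a 2 μ x - winMoment h n a 1 μ x ^ 2 := by
  have hN' : (n * h : ℝ) ≠ 0 := by exact_mod_cast hN.ne'
  obtain ⟨hn, hh⟩ := mul_ne_zero_iff.1 hN'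
  have h1 := sum_pow_eq_winMoment a μ x hN 1
  have h2 := sum_pow_eq_winMoment a μ x hN 2
  rw [empVar, empCenteredMoment, empMean_eq_winMoment a μ x hN]
  set m := winMoment h n a 1 μ x
  have e : ∀ i, (x i - (μ + m)) ^ 2 = (x i - μ) ^ 2 - 2 * m * (x i - μ) ^ 1 + m ^ 2 := by
    intro i; ring
  simp only [e, Finset.sum_add_distrib, Finset.sum_sub_distrib, ← Finset.mul_sum, h1, h2,
    Finset.sum_const, card_window, nsmul_eq_mul, Nat.cast_mul]
  field_simp
  ring

lemma empNuSq_eq_winMoment (hN : 0 < n * h) :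
    empNuSq h n (Finset.Ioc (n * a) (n * (a + h))) x =
      winMoment h n a 4 μ x - 4 * winMoment h n a 1 μ x * winMoment h n a 3 μ x
        + 6 * winMoment h n a 1 μ x ^ 2 * winMoment h n a 2 μ x
        - 3 * winMoment h n a 1 μ x ^ 4
        - (winMoment h n a 2 μ x - winMoment h n a 1 μ x ^ 2) ^ 2 := by
  have hN' : (n * h : ℝ) ≠ 0 := by exact_mod_cast hN.ne'
  obtain ⟨hn, hh⟩ := mul_ne_zero_iff.1 hN'
  have h1 := sum_pow_eq_winMoment a μ x hN 1
  have h2 := sum_pow_eq_winMoment a μ x hN 2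
  have h3 := sum_pow_eq_winMoment a μ x hN 3
  have h4 := sum_pow_eq_winMoment a μ x hN 4
  rw [empNuSq, empVar_eq_winMoment a μ x hN, empCenteredMoment, empMean_eq_winMoment a μ x hN]
  set m := winMoment h n a 1 μ x
  have e : ∀ i, (x i - (μ + m)) ^ 4 = (x i - μ) ^ 4 - 4 * m * (x i - μ) ^ 3
      + 6 * m ^ 2 * (x i - μ) ^ 2 - 4 * m ^ 3 * (x i - μ) ^ 1 + m ^ 4 := by
    intro i; ring
  simp only [e, Finset.sum_add_distrib, Finset.sum_sub_distrib, ← Finset.mul_sum, h1, h2, h3, h4,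
    Finset.sum_const, card_window, nsmul_eq_mul, Nat.cast_mul]
  field_simp
  ring

end Estimators

lemma leftWindow_eq (h n a : ℕ) :
    leftWindow h n ((a + h : ℕ) : ℝ) = Finset.Ioc (n * a) (n * (a + h)) := by
  have e1 : (n : ℝ) * (((a + h : ℕ) : ℝ) - h) = ((n * a : ℕ) : ℝ) := by push_cast; ring
  have e2 : (n : ℝ) * ((a + h : ℕ) : ℝ) = ((n * (a + h) : ℕ) : ℝ) := by push_cast; ring
  rw [leftWindow, e1, e2, Nat.floor_natCast, Nat.floor_natCast]

lemma rightWindow_eq (h n t : ℕ) :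
    rightWindow h n (t : ℝ) = Finset.Ioc (n * t) (n * (t + h)) := by
  have e1 : (n : ℝ) * ((t : ℝ) + h) = ((n * (t + h) : ℕ) : ℝ) := by push_cast; ring
  have e2 : (n : ℝ) * (t : ℝ) = ((n * t : ℕ) : ℝ) := by push_cast; ring
  rw [rightWindow, e1, e2, Nat.floor_natCast, Nat.floor_natCast]

lemma segment_eq_castSucc {m h n a i : ℕ} {c : Fin m → ℕ} (hc : StrictMono c) {u : Fin m}
    (hu : c u = a + h)
    (hfree : ∀ v : Fin m, (c v : ℤ) ∈ Set.Ioc ((c u : ℤ) - h) ((c u : ℤ) + h) → v = u)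
    (hi : i ∈ Finset.Ioc (n * a) (n * (a + h))) : segment c n i = u.castSucc := by
  rw [Finset.mem_Ioc] at hi
  have e : (Finset.univ.filter fun v => n * c v < i) = Finset.Iio u := by
    ext v
    simp only [Finset.mem_filter_univ, Finset.mem_Iio]
    constructor
    · intro hv
      by_contra! huv
      have := Nat.mul_le_mul_left n (hc.monotone huv)
      rw [hu] at this
      omega
    · intro hv
      have hlt := hc hv
      have hle : c v ≤ a := by
        by_contra! hav
        exact hv.ne (hfree v ⟨by omega, by omega⟩)
      exact (Nat.mul_le_mul_left n hle).trans_lt hi.1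
  ext
  simp [segment, e]

lemma segment_eq_succ {m h n i : ℕ} {c : Fin m → ℕ} (hc : StrictMono c) {u : Fin m}
    (hfree : ∀ v : Fin m, (c v : ℤ) ∈ Set.Ioc ((c u : ℤ) - h) ((c u : ℤ) + h) → v = u)
    (hi : i ∈ Finset.Ioc (n * c u) (n * (c u + h))) : segment c n i = u.succ := by
  rw [Finset.mem_Ioc] at hi
  have e : (Finset.univ.filter fun v => n * c v < i) = Finset.Iic u := by
    ext v
    simp only [Finset.mem_filter_univ, Finset.mem_Iic]
    constructor
    · intro hv
      by_contra! huv
      have hlt := hc huv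
      have hle : c u + h ≤ c v := by
        by_contra! hav
        exact huv.ne' (hfree v ⟨by omega, by omega⟩)
      have := Nat.mul_le_mul_left n hle
      omega
    · intro hv
      exact (Nat.mul_le_mul_left n (hc.monotone hv)).trans_lt hi.1
  ext
  simp [segment, e]

/-! ### The centered statistic as a function of window moments -/

/-- Studentizing a difference and subtracting the rescaled centering is the same as centering the
difference first, normalizing it by the population scale, and correcting the scale afterwards.
No hypothesis on the estimated scale `b` is needed: both sides vanish if `√b = 0`. -/
lemma studentized_sub_scaled {s N : ℝ} (b e d : ℝ) (hs : 0 < s) (hN : 0 ≤ N) :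
    e / √(b / N) - √(s / b) * (d / √(s / N)) = √s / √b * (√N / √s * (e - d)) := by
  have hs' : √s ≠ 0 := (Real.sqrt_pos.2 hs).ne'
  rw [Real.sqrt_div' b hN, Real.sqrt_div hs.le, Real.sqrt_div' s hN]
  rcases eq_or_ne (√b) 0 with hb | hb
  · simp [hb]
  rcases eq_or_ne (√N) 0 with h0 | h0
  · simp [h0]
  field_simp

section Decomposition

variable {Ω : Type*} [MeasurableSpace Ω] (P : Measure Ω) (Y Z : ℕ → Ω → ℝ)

/-- The normalized differences between the two windows of the first two moments, centered and
scaled with the population parameters. The left window starts after `n a`, the right one after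
`n b`. -/
def normalizedDiff (h a b n : ℕ) (ω : Ω) : EuclideanSpace ℝ (Fin 2) :=
  !₂[√(n * h : ℝ) / √(popVar P Z + popVar P Y) *
      (winMoment h n b 1 (popMean P Z) (Z · ω) - winMoment h n a 1 (popMean P Y) (Y · ω)),
    √(n * h : ℝ) / √(popNuSq P Z + popNuSq P Y) *
      ((winMoment h n b 2 (popMean P Z) (Z · ω) - popVar P Z) -
        (winMoment h n a 2 (popMean P Y) (Y · ω) - popVar P Y))]

/-- The sum over both windows of the estimators of the variance. -/
def varEstimator (h a b n : ℕ) (ω : Ω) : ℝ :=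
  empVar h n (Finset.Ioc (n * b) (n * (b + h))) (Z · ω) +
    empVar h n (Finset.Ioc (n * a) (n * (a + h))) (Y · ω)

/-- The sum over both windows of the estimators of `ν²`. -/
def nuSqEstimator (h a b n : ℕ) (ω : Ω) : ℝ :=
  empNuSq h n (Finset.Ioc (n * b) (n * (b + h))) (Z · ω) +
    empNuSq h n (Finset.Ioc (n * a) (n * (a + h))) (Y · ω)

/-- The random coefficients by which the centered statistic differs from `normalizedDiff`: the two
ratios of population scale to estimated scale, and the coefficient of the quadratic error that
stems from centering at the empirical means. Their limits are `1`, `1` and `0`. -/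
def correction (h a b n : ℕ) (ω : Ω) : ℝ × ℝ × ℝ :=
  (√(popVar P Z + popVar P Y) / √(varEstimator Y Z h a b n ω),
    √(popNuSq P Z + popNuSq P Y) / √(nuSqEstimator Y Z h a b n ω),
    √(popVar P Z + popVar P Y) / √(nuSqEstimator Y Z h a b n ω) *
      (winMoment h n b 1 (popMean P Z) (Z · ω) + winMoment h n a 1 (popMean P Y) (Y · ω)))

/-- The map that combines `normalizedDiff` and `correction` into the centered statistic. -/
def applyCorrection (p : EuclideanSpace ℝ (Fin 2) × (ℝ × ℝ × ℝ)) : EuclideanSpace ℝ (Fin 2) :=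
  !₂[p.2.1 * p.1 0, p.2.2.1 * p.1 1 - p.2.2.2 * p.1 0]

lemma continuous_applyCorrection : Continuous applyCorrection := by
  unfold applyCorrection
  refine (PiLp.continuous_toLp 2 _).comp (continuous_pi fun i => ?_)
  fin_cases i <;> simp <;> fun_prop

lemma applyCorrection_one_one_zero (z : EuclideanSpace ℝ (Fin 2)) : applyCorrection (z, 1, 1, 0) = z := by
  ext i
  fin_cases i <;> simp [applyCorrection]

/-- The quadratic error `√N (b₁² - a₁²)` of the variance estimators factors as
`√N (b₁ - a₁) · (b₁ + a₁)`, the first coordinate of `normalizedDiff` times a null sequence. -/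
lemma statJ_sub_scaling_mulVec_centering (h a n : ℕ) (ω : Ω) (x : ℕ → ℝ)
    (hxY : ∀ i ∈ Finset.Ioc (n * a) (n * (a + h)), x i = Y i ω)
    (hxZ : ∀ i ∈ Finset.Ioc (n * (a + h)) (n * (a + h + h)), x i = Z i ω)
    (hσ : 0 < popVar P Z + popVar P Y) (hν : 0 < popNuSq P Z + popNuSq P Y) :
    WithLp.toLp 2 (statJ h n (a + h : ℕ) x -
        scaling P Y Z h n (a + h : ℕ) x *ᵥ centering P Y Z h n) =
      applyCorrection (normalizedDiff P Y Z h a (a + h) n ω, correction P Y Z h a (a + h) n ω) := by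
  have hN : (0 : ℝ) ≤ n * h := by positivity
  have hσ' : √(popVar P Z + popVar P Y) ≠ 0 := (Real.sqrt_pos.2 hσ).ne'
  have hν' : √(popNuSq P Z + popNuSq P Y) ≠ 0 := (Real.sqrt_pos.2 hν).ne'
  have eE : statJ h n (a + h : ℕ) x 0 - (scaling P Y Z h n (a + h : ℕ) x *ᵥ
      centering P Y Z h n) 0 =
      √(popVar P Z + popVar P Y) / √(varEstimator Y Z h a (a + h) n ω) *
        (√(n * h : ℝ) / √(popVar P Z + popVar P Y) *
          (empMean h n (Finset.Ioc (n * (a + h)) (n * (a + h + h))) (Z · ω) -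
            empMean h n (Finset.Ioc (n * a) (n * (a + h))) (Y · ω) -
              (popMean P Z - popMean P Y))) := by
    rw [← studentized_sub_scaled _ _ _ hσ hN]
    simp only [statJ, scaling, centering, statE, varEstimator, leftWindow_eq, rightWindow_eq,
      Matrix.cons_val_zero, Matrix.mulVec, empMean, empVar, empMoment_congr h n _ hxY,
      empMoment_congr h n _ hxZ, empCenteredMoment_congr h n _ hxY,
      empCenteredMoment_congr h n _ hxZ, Matrix.of_apply, Matrix.cons_val', dotProduct,
      Fin.sum_univ_two, Matrix.cons_val_one, zero_mul, add_zero, Matrix.cons_val_fin_one]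
  have eV : statJ h n (a + h : ℕ) x 1 - (scaling P Y Z h n (a + h : ℕ) x *ᵥ
      centering P Y Z h n) 1 =
      √(popNuSq P Z + popNuSq P Y) / √(nuSqEstimator Y Z h a (a + h) n ω) *
        (√(n * h : ℝ) / √(popNuSq P Z + popNuSq P Y) *
          (empVar h n (Finset.Ioc (n * (a + h)) (n * (a + h + h))) (Z · ω) -
            empVar h n (Finset.Ioc (n * a) (n * (a + h))) (Y · ω) -
              (popVar P Z - popVar P Y))) := by
    rw [← studentized_sub_scaled _ _ _ hν hN]
    simp only [statJ, scaling, centering, statV, nuSqEstimator, leftWindow_eq, rightWindow_eq,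
      Matrix.cons_val_zero, Matrix.mulVec, empNuSq, empVar, empCenteredMoment_congr h n _ hxY,
      empCenteredMoment_congr h n _ hxZ, Matrix.of_apply, Matrix.cons_val', dotProduct,
      Fin.sum_univ_two, Matrix.cons_val_one, zero_mul, zero_add, Matrix.cons_val_fin_one]
  -- For an empty window the moment identities fail, but both sides vanish with the factor `√(n h)`.
  rcases Nat.eq_zero_or_pos (n * h) with h0 | h0
  · have h0' : (n * h : ℝ) = 0 := by exact_mod_cast h0
    rw [h0'] at eE eV
    ext i
    fin_cases i
    · simpa [applyCorrection, normalizedDiff, h0'] using eE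
    · simpa [applyCorrection, normalizedDiff, h0'] using eV
  · rw [empMean_eq_winMoment a (popMean P Y) _ h0,
      empMean_eq_winMoment (a + h) (popMean P Z) _ h0] at eE
    rw [empVar_eq_winMoment a (popMean P Y) _ h0,
      empVar_eq_winMoment (a + h) (popMean P Z) _ h0] at eV
    ext i
    fin_cases i
    · refine eE.trans ?_
      simp only [applyCorrection, normalizedDiff, correction, Fin.zero_eta, PiLp.toLp_apply,
        Matrix.cons_val_zero]
      ring
    · refine eV.trans ?_
      simp only [applyCorrection, normalizedDiff, correction, Fin.mk_one, PiLp.toLp_apply,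
        Matrix.cons_val_zero, Matrix.cons_val_one, Matrix.cons_val_fin_one]
      field_simp
      ring

end Decomposition

/-! ### Moments of an auxiliary process -/

section Moments

variable {Ω : Type*} [MeasurableSpace Ω] {P : Measure Ω} {Y : ℕ → Ω → ℝ}

lemma IsAuxiliaryProcess.popCenteredMoment_two (hY : IsAuxiliaryProcess P Y) :
    popCenteredMoment P Y 2 = popVar P Y := by
  rw [popVar, variance_eq_integral (hY.measurable 1 le_rfl).aemeasurable]
  rfl

lemma IsAuxiliaryProcess.iIndepFun_comp (hY : IsAuxiliaryProcess P Y) {f : ℝ → ℝ}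
    (hf : Measurable f) : iIndepFun (fun i ω => f (Y (i + 1) ω)) P :=
  hY.indep.comp (fun _ => f) fun _ => hf

lemma IsAuxiliaryProcess.identDistrib_comp (hY : IsAuxiliaryProcess P Y) {f : ℝ → ℝ}
    (hf : Measurable f) (i : ℕ) :
    IdentDistrib (fun ω => f (Y (i + 1) ω)) (fun ω => f (Y (0 + 1) ω)) P P :=
  (hY.ident (i + 1) (by omega)).comp hf

variable [IsProbabilityMeasure P]

lemma IsAuxiliaryProcess.memLp_sub (hY : IsAuxiliaryProcess P Y) (μ : ℝ) :
    MemLp (fun ω => Y 1 ω - μ) 4 P := by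
  have h4 : MemLp (Y 1) 4 P := by
    rw [← integrable_norm_rpow_iff (hY.measurable 1 le_rfl).aestronglyMeasurable (by norm_num)
      (by norm_num)]
    refine hY.fourth_moment.congr (ae_of_all _ fun ω => ?_)
    simp only [Real.norm_eq_abs]
    norm_num
  exact h4.sub (memLp_const μ)

lemma IsAuxiliaryProcess.integrable_sub_pow (hY : IsAuxiliaryProcess P Y) (μ : ℝ) {k : ℕ}
    (hk : k ≤ 4) : Integrable (fun ω => (Y 1 ω - μ) ^ k) P := by
  have hm : MemLp (fun ω => Y 1 ω - μ) (k : ENNReal) P :=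
    (hY.memLp_sub μ).mono_exponent (by exact_mod_cast hk)
  refine (integrable_norm_iff ?_).1 ?_
  · exact (((hY.measurable 1 le_rfl).sub_const μ).pow_const k).aestronglyMeasurable
  · simpa only [norm_pow] using hm.integrable_norm_pow'

lemma IsAuxiliaryProcess.popCenteredMoment_one (hY : IsAuxiliaryProcess P Y) :
    popCenteredMoment P Y 1 = 0 := by
  have hi : Integrable (Y 1) P := by simpa using hY.integrable_sub_pow 0 (k := 1) (by norm_num)
  simp only [popCenteredMoment, pow_one]
  rw [integral_sub hi (integrable_const _)]
  simp [popMean]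

/-- The function whose block sums are the linear combinations, with coefficients `α` and `β`, of
the centered first two moments. -/
def score (μ v α β y : ℝ) : ℝ := α * (y - μ) + β * ((y - μ) ^ 2 - v)

lemma measurable_score (μ v α β : ℝ) : Measurable (score μ v α β) := by
  unfold score; fun_prop

lemma IsAuxiliaryProcess.memLp_sq_sub (hY : IsAuxiliaryProcess P Y) (μ v : ℝ) :
    MemLp (fun ω => (Y 1 ω - μ) ^ 2 - v) 2 P := by
  refine MemLp.sub ?_ (memLp_const v)
  refine (memLp_two_iff_integrable_sq ?_).2 ?_
  · exact (((hY.measurable 1 le_rfl).sub_const μ).pow_const 2).aestronglyMeasurable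
  · simpa only [← pow_mul] using hY.integrable_sub_pow μ (k := 4) le_rfl

lemma IsAuxiliaryProcess.memLp_score (hY : IsAuxiliaryProcess P Y) (μ v α β : ℝ) :
    MemLp (fun ω => score μ v α β (Y 1 ω)) 2 P :=
  (((hY.memLp_sub μ).mono_exponent (by norm_num)).const_mul α).add
    ((hY.memLp_sq_sub μ v).const_mul β)

lemma IsAuxiliaryProcess.popNuSq_eq (hY : IsAuxiliaryProcess P Y) :
    popNuSq P Y = popCenteredMoment P Y 4 - popVar P Y ^ 2 := by
  have hm := hY.memLp_sq_sub (popMean P Y) 0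
  simp only [sub_zero] at hm
  rw [popNuSq, variance_eq_sub hm, ← hY.popCenteredMoment_two]
  simp only [popCenteredMoment, Pi.pow_apply, ← pow_mul]

lemma IsAuxiliaryProcess.integral_sum_mul_pow (hY : IsAuxiliaryProcess P Y) (b : ℕ → ℝ) :
    ∫ ω, ∑ k ∈ Finset.range 5, b k * (Y 1 ω - popMean P Y) ^ k ∂P =
      ∑ k ∈ Finset.range 5, b k * popCenteredMoment P Y k := by
  rw [integral_finsetSum]
  · simp only [integral_const_mul, popCenteredMoment]
  · intro k hk
    exact (hY.integrable_sub_pow _ (by rw [Finset.mem_range] at hk; omega)).const_mul _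

lemma popCenteredMoment_zero : popCenteredMoment P Y 0 = 1 := by simp [popCenteredMoment]

lemma IsAuxiliaryProcess.integral_score (hY : IsAuxiliaryProcess P Y) (α β : ℝ) :
    ∫ ω, score (popMean P Y) (popVar P Y) α β (Y 1 ω) ∂P = 0 := by
  have hi := hY.integral_sum_mul_pow fun k => [-β * popVar P Y, α, β].getD k 0
  simp only [Finset.sum_range_succ, Finset.sum_range_zero, hY.popCenteredMoment_one,
    hY.popCenteredMoment_two, popCenteredMoment_zero, List.getD_cons_zero,
    List.getD_cons_succ, List.getD_nil] at hi
  calc _ = _ := integral_congr_ae (ae_of_all _ fun ω => by simp only [score]; ring)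
    _ = _ := hi
    _ = 0 := by ring

/-- The covariance matrix of `(Y - μ, (Y - μ)²)` has the entries `σ²`, `μ^{3}` and `ν²`. -/
lemma IsAuxiliaryProcess.variance_score (hY : IsAuxiliaryProcess P Y) (α β : ℝ) :
    Var[fun ω => score (popMean P Y) (popVar P Y) α β (Y 1 ω); P] =
      α ^ 2 * popVar P Y + 2 * α * β * popCenteredMoment P Y 3 + β ^ 2 * popNuSq P Y := by
  rw [variance_eq_sub (hY.memLp_score _ _ α β), hY.integral_score, hY.popNuSq_eq]
  have hi := hY.integral_sum_mul_pow fun k => [β ^ 2 * popVar P Y ^ 2, -2 * α * β * popVar P Y,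
    α ^ 2 - 2 * β ^ 2 * popVar P Y, 2 * α * β, β ^ 2].getD k 0
  simp only [Finset.sum_range_succ, Finset.sum_range_zero, hY.popCenteredMoment_one,
    hY.popCenteredMoment_two, popCenteredMoment_zero, List.getD_cons_zero,
    List.getD_cons_succ] at hi
  have e : ∫ ω, ((fun ω => score (popMean P Y) (popVar P Y) α β (Y 1 ω)) ^ 2) ω ∂P = _ :=
    (integral_congr_ae (ae_of_all _ fun ω => by
      simp only [Pi.pow_apply, score]; ring)).trans hi
  rw [e]
  ring

end Moments

/-! ### Limit theorems for block sums -/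

section BlockSums

variable {Ω : Type*} [MeasurableSpace Ω] {P : Measure Ω} [IsProbabilityMeasure P]

/-- The central limit theorem for sums over blocks with varying starting points. Since the
variables are i.i.d., the law of a block sum depends on the length of the block only. -/
lemma tendsto_charFun_blockSum {ξ : ℕ → Ω → ℝ} (hindep : iIndepFun ξ P)
    (hident : ∀ i, IdentDistrib (ξ i) (ξ 0) P P) (h2 : MemLp (ξ 0) 2 P) (h0 : P[ξ 0] = 0)
    (s : ℕ → ℕ) {N : ℕ → ℕ} (hN : Tendsto N atTop atTop) (t : ℝ) :
    Tendsto (fun n => charFun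
        (P.map fun ω => (√(N n))⁻¹ * ∑ k ∈ Finset.range (N n), ξ (s n + k) ω) t)
      atTop (nhds (Complex.exp (-((Var[ξ 0; P] * t ^ 2 / 2 : ℝ) : ℂ)))) := by
  have hshift : ∀ n, charFun
      (P.map fun ω => (√(N n))⁻¹ * ∑ k ∈ Finset.range (N n), ξ (s n + k) ω) t =
      charFun (P.map fun ω => (√(N n))⁻¹ * ∑ k ∈ Finset.range (N n), ξ k ω) t := by
    intro n
    -- Both sides are the same power of the characteristic function of a single variable.
    rw [charFun_inv_sqrt_mul_sum hindep hident,
      charFun_inv_sqrt_mul_sum (X := fun k => ξ (s n + k))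
        (hindep.precomp (add_right_injective (s n)))
        (fun i => (hident _).trans (hident _).symm), (hident (s n + 0)).map_eq]
  simp only [hshift]
  have hclt := tendstoInDistribution_inv_sqrt_mul_sum_sub (X := ξ) (P := P) (Y := id)
    (P' := gaussianReal 0 Var[ξ 0; P].toNNReal) ⟨aemeasurable_id, Measure.map_id⟩ h2 hindep hident
  have hchar := (ProbabilityMeasure.tendsto_iff_tendsto_charFun.1 hclt.tendsto t).comp hN
  simp only [h0, mul_zero, sub_zero, ProbabilityMeasure.coe_mk, Function.comp_def, Measure.map_id,
    charFun_gaussianReal] at hchar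
  convert! hchar using 2
  simp [Real.coe_toNNReal _ (variance_nonneg _ _)]

/-- The strong law of large numbers for windows that move with `n`: a window sum is the difference
of two partial sums. -/
lemma IsAuxiliaryProcess.ae_tendsto_winMoment {Y : ℕ → Ω → ℝ} (hY : IsAuxiliaryProcess P Y)
    {h : ℕ} (hh : 0 < h) (a : ℕ) {k : ℕ} (hk : k ≤ 4) :
    ∀ᵐ ω ∂P, Tendsto (fun n => winMoment h n a k (popMean P Y) (Y · ω)) atTop
      (nhds (popCenteredMoment P Y k)) := by
  have hf : Measurable fun y : ℝ => (y - popMean P Y) ^ k := by fun_prop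
  have hslln := strong_law_ae_real (fun i ω => (Y (i + 1) ω - popMean P Y) ^ k)
    (hY.integrable_sub_pow _ hk) (fun i j hij => (hY.iIndepFun_comp hf).indepFun hij)
    (hY.identDistrib_comp hf)
  filter_upwards [hslln] with ω hω
  set S : ℕ → ℝ := fun n => ∑ i ∈ Finset.range n, (Y (i + 1) ω - popMean P Y) ^ k with hS
  have hpart : ∀ b : ℕ, Tendsto (fun n => S (n * b) / n) atTop
      (nhds (b * popCenteredMoment P Y k)) := by
    intro b
    rcases Nat.eq_zero_or_pos b with rfl | hb
    · simp [hS]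
    · have hlim := (hω.comp (tendsto_id.atTop_mul_const' hb)).const_mul (b : ℝ)
      refine hlim.congr fun n => ?_
      have hb' : (b : ℝ) ≠ 0 := by exact_mod_cast hb.ne'
      simp only [Function.comp_apply, id_eq, Nat.cast_mul, hS]
      rw [mul_comm (n : ℝ), mul_div_assoc', mul_div_mul_left _ _ hb']
  have hh' : (h : ℝ) ≠ 0 := by exact_mod_cast hh.ne'
  have hlim := ((hpart (a + h)).sub (hpart a)).const_mul (h : ℝ)⁻¹
  have e : (h : ℝ)⁻¹ * (((a + h : ℕ) : ℝ) * popCenteredMoment P Y k -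
      a * popCenteredMoment P Y k) = popCenteredMoment P Y k := by
    push_cast; field_simp; ring
  rw [e] at hlim
  refine hlim.congr fun n => ?_
  rw [winMoment_eq_sum_range, hS]
  simp only [mul_add n a h, Finset.sum_range_add, Nat.cast_mul, mul_inv, add_assoc]
  ring

end BlockSums

section TwoSided

variable {Ω : Type*} [MeasurableSpace Ω] {P : Measure Ω} {Y Z : ℕ → Ω → ℝ}

/-! ### Measurability -/

lemma IsAuxiliaryProcess.measurable_winMoment (hY : IsAuxiliaryProcess P Y) (h n a k : ℕ)
    (μ : ℝ) : Measurable fun ω => winMoment h n a k μ (Y · ω) := by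
  simp only [winMoment_eq_sum_range]
  refine (Finset.measurable_fun_sum _ fun j _ => ?_).const_mul _
  exact ((hY.measurable _ (by omega)).sub_const μ).pow_const k

lemma measurable_normalizedDiff (hY : IsAuxiliaryProcess P Y) (hZ : IsAuxiliaryProcess P Z)
    (h a b n : ℕ) : Measurable (normalizedDiff P Y Z h a b n) := by
  have m1 := hY.measurable_winMoment h n a 1 (popMean P Y)
  have m2 := hY.measurable_winMoment h n a 2 (popMean P Y)
  have m3 := hZ.measurable_winMoment h n b 1 (popMean P Z)
  have m4 := hZ.measurable_winMoment h n b 2 (popMean P Z)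
  refine (PiLp.continuous_toLp 2 _).measurable.comp (measurable_pi_lambda _ fun i => ?_)
  fin_cases i <;> simp <;> fun_prop

lemma measurable_empCenteredMoment {x : ℕ → Ω → ℝ} (h n k : ℕ) {I : Finset ℕ}
    (hx : ∀ i ∈ I, Measurable (x i)) :
    Measurable fun ω => empCenteredMoment h n I k (x · ω) := by
  unfold empCenteredMoment empMean empMoment
  refine (Finset.measurable_fun_sum _ fun i hi => ?_).const_mul _
  refine ((hx i hi).sub ((Finset.measurable_fun_sum _ fun j hj => ?_).const_mul _)).pow_const k
  exact (hx j hj).pow_const 1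

lemma measurable_correction (hY : IsAuxiliaryProcess P Y) (hZ : IsAuxiliaryProcess P Z)
    (h a b n : ℕ) : Measurable (correction P Y Z h a b n) := by
  have hm : ∀ {W : ℕ → Ω → ℝ}, IsAuxiliaryProcess P W → ∀ d k, Measurable fun ω =>
      empCenteredMoment h n (Finset.Ioc (n * d) (n * (d + h))) k (W · ω) := by
    intro W hW d k
    refine measurable_empCenteredMoment h n k fun i hi => hW.measurable i ?_
    rw [Finset.mem_Ioc] at hi
    omega
  have y2 := hm hY a 2
  have y4 := hm hY a 4
  have z2 := hm hZ b 2
  have z4 := hm hZ b 4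
  have m1 := hY.measurable_winMoment h n a 1 (popMean P Y)
  have m3 := hZ.measurable_winMoment h n b 1 (popMean P Z)
  unfold correction varEstimator nuSqEstimator empNuSq empVar
  fun_prop

/-! ### The limit law of the normalized differences -/

/-- Every linear functional of `normalizedDiff` is the sum of one block sum for each window. -/
lemma inner_normalizedDiff (h a b n : ℕ) (t : EuclideanSpace ℝ (Fin 2)) (ω : Ω) :
    inner ℝ (normalizedDiff P Y Z h a b n ω) t =
      (√((n * h : ℕ) : ℝ))⁻¹ * ∑ k ∈ Finset.range (n * h),
        score (popMean P Z) (popVar P Z) (t 0 / √(popVar P Z + popVar P Y))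
          (t 1 / √(popNuSq P Z + popNuSq P Y)) (Z (n * b + k + 1) ω) +
      (√((n * h : ℕ) : ℝ))⁻¹ * ∑ k ∈ Finset.range (n * h),
        score (popMean P Y) (popVar P Y) (-(t 0 / √(popVar P Z + popVar P Y)))
          (-(t 1 / √(popNuSq P Z + popNuSq P Y))) (Y (n * a + k + 1) ω) := by
  rw [EuclideanSpace.inner_eq_star_dotProduct]
  simp only [normalizedDiff, winMoment_eq_sum_range, score, dotProduct, Fin.sum_univ_two,
    Finset.sum_add_distrib, ← Finset.mul_sum, Finset.sum_sub_distrib, Finset.sum_const,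
    Finset.card_range, nsmul_eq_mul, pow_one, star_trivial, Matrix.cons_val_zero,
    Matrix.cons_val_one, Matrix.cons_val_fin_one, ← Nat.cast_mul]
  rcases Nat.eq_zero_or_pos (n * h) with h0 | h0
  · simp [h0]
  have hN : (0 : ℝ) < ((n * h : ℕ) : ℝ) := by exact_mod_cast h0
  set N : ℝ := ((n * h : ℕ) : ℝ)
  have hs : √N ≠ 0 := (Real.sqrt_pos.2 hN).ne'
  have hi : N⁻¹ = (√N)⁻¹ * (√N)⁻¹ := by rw [← mul_inv, Real.mul_self_sqrt hN.le]
  have hN' : N = √N * √N := (Real.mul_self_sqrt hN.le).symm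
  rw [hi]
  generalize √N = r at *
  rw [hN']
  field_simp
  ring

lemma charFun_map_eq_charFun_map_inner {E : Type*} [NormedAddCommGroup E]
    [InnerProductSpace ℝ E] [MeasurableSpace E] [BorelSpace E] [SecondCountableTopology E]
    {G : Ω → E} (hG : Measurable G) (t : E) :
    charFun (P.map G) t = charFun (P.map fun ω => inner ℝ (G ω) t) 1 := by
  have hi : Measurable fun ω => inner ℝ (G ω) t := by fun_prop
  rw [charFun_apply, charFun_apply, integral_map hG.aemeasurable (by fun_prop),
    integral_map hi.aemeasurable (by fun_prop)]
  simp

variable [IsProbabilityMeasure P]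

/-- The quadratic form of `Γ` is the sum of two variances, one for each side. -/
lemma dotProduct_gammaC_mulVec (hY : IsAuxiliaryProcess P Y) (hZ : IsAuxiliaryProcess P Z)
    (hσ : 0 < popVar P Z + popVar P Y) (hν : 0 < popNuSq P Z + popNuSq P Y) (t : Fin 2 → ℝ) :
    t ⬝ᵥ gammaC P Y Z *ᵥ t =
      Var[fun ω => score (popMean P Z) (popVar P Z) (t 0 / √(popVar P Z + popVar P Y))
        (t 1 / √(popNuSq P Z + popNuSq P Y)) (Z 1 ω); P] +
      Var[fun ω => score (popMean P Y) (popVar P Y) (-(t 0 / √(popVar P Z + popVar P Y)))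
        (-(t 1 / √(popNuSq P Z + popNuSq P Y))) (Y 1 ω); P] := by
  have hσ' : √(popVar P Z + popVar P Y) ≠ 0 := (Real.sqrt_pos.2 hσ).ne'
  have hν' : √(popNuSq P Z + popNuSq P Y) ≠ 0 := (Real.sqrt_pos.2 hν).ne'
  have h1 := Real.sq_sqrt hσ.le
  have h2 := Real.sq_sqrt hν.le
  rw [hZ.variance_score, hY.variance_score]
  simp only [gammaC, rhoC, Matrix.mulVec, dotProduct, Fin.sum_univ_two, Matrix.of_apply,
    Matrix.cons_val', Matrix.cons_val_zero, Matrix.cons_val_one, Matrix.cons_val_fin_one]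
  set S := √(popVar P Z + popVar P Y)
  set V := √(popNuSq P Z + popNuSq P Y)
  have e1 : popVar P Z = S ^ 2 - popVar P Y := by linarith
  have e2 : popNuSq P Z = V ^ 2 - popNuSq P Y := by linarith
  rw [e1, e2]
  field_simp
  ring

lemma posSemidef_gammaC (hY : IsAuxiliaryProcess P Y) (hZ : IsAuxiliaryProcess P Z)
    (hσ : 0 < popVar P Z + popVar P Y) (hν : 0 < popNuSq P Z + popNuSq P Y) :
    (gammaC P Y Z).PosSemidef := by
  refine Matrix.PosSemidef.of_dotProduct_mulVec_nonneg ?_ fun t => ?_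
  · ext i j
    fin_cases i <;> fin_cases j <;> simp [gammaC]
  · rw [star_trivial, dotProduct_gammaC_mulVec hY hZ hσ hν]
    exact add_nonneg (variance_nonneg _ _) (variance_nonneg _ _)

/-- Block sums of a function of an auxiliary process converge in law to a normal variable. -/
lemma IsAuxiliaryProcess.tendsto_charFun_score (hY : IsAuxiliaryProcess P Y) {h : ℕ}
    (hh : 0 < h) (a : ℕ) (α β : ℝ) :
    Tendsto (fun n : ℕ => charFun (P.map fun ω => (√((n * h : ℕ) : ℝ))⁻¹ *
        ∑ k ∈ Finset.range (n * h),
          score (popMean P Y) (popVar P Y) α β (Y (n * a + k + 1) ω)) 1) atTop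
      (nhds (Complex.exp (-((Var[fun ω => score (popMean P Y) (popVar P Y) α β (Y 1 ω); P] / 2 :
        ℝ) : ℂ)))) := by
  have hm := measurable_score (popMean P Y) (popVar P Y) α β
  have hlim := tendsto_charFun_blockSum (hY.iIndepFun_comp hm) (hY.identDistrib_comp hm)
    (hY.memLp_score _ _ α β) (hY.integral_score α β) (fun n => n * a)
    (tendsto_id.atTop_mul_const' hh) 1
  simpa only [one_pow, mul_one, id_eq, zero_add] using hlim

theorem tendstoInDistribution_normalizedDiff (hY : IsAuxiliaryProcess P Y)
    (hZ : IsAuxiliaryProcess P Z)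
    (hindep : IndepFun (fun ω (i : ℕ) => Y (i + 1) ω) (fun ω (i : ℕ) => Z (i + 1) ω) P)
    (hσ : 0 < popVar P Z + popVar P Y) (hν : 0 < popNuSq P Z + popNuSq P Y)
    {h : ℕ} (hh : 0 < h) (a b : ℕ) :
    TendstoInDistribution (normalizedDiff P Y Z h a b) atTop
      (id : EuclideanSpace ℝ (Fin 2) → EuclideanSpace ℝ (Fin 2)) (fun _ => P)
      (multivariateGaussian 0 (gammaC P Y Z)) where
  forall_aemeasurable n := (measurable_normalizedDiff hY hZ h a b n).aemeasurable
  tendsto := by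
    refine ProbabilityMeasure.tendsto_iff_tendsto_charFun.2 fun t => ?_
    simp only [ProbabilityMeasure.coe_mk, Measure.map_id]
    rw [charFun_multivariateGaussian (posSemidef_gammaC hY hZ hσ hν),
      dotProduct_gammaC_mulVec hY hZ hσ hν]
    have hprod := (hZ.tendsto_charFun_score hh b (t 0 / √(popVar P Z + popVar P Y))
      (t 1 / √(popNuSq P Z + popNuSq P Y))).mul
      (hY.tendsto_charFun_score hh a (-(t 0 / √(popVar P Z + popVar P Y)))
      (-(t 1 / √(popNuSq P Z + popNuSq P Y))))
    rw [← Complex.exp_add] at hprod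
    convert! hprod using 2 with n
    · rw [charFun_map_eq_charFun_map_inner (measurable_normalizedDiff hY hZ h a b n)]
      simp only [inner_normalizedDiff]
      have hφ : ∀ (μ v α β : ℝ) (s : ℕ), Measurable fun y : ℕ → ℝ =>
          (√((n * h : ℕ) : ℝ))⁻¹ * ∑ k ∈ Finset.range (n * h), score μ v α β (y (s + k)) := by
        intro μ v α β s
        refine (Finset.measurable_fun_sum _ fun k _ => ?_).const_mul _
        exact (measurable_score μ v α β).comp (measurable_pi_apply _)
      have hseq : ∀ {W : ℕ → Ω → ℝ}, IsAuxiliaryProcess P W →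
          Measurable fun ω (i : ℕ) => W (i + 1) ω :=
        fun hW => measurable_pi_lambda _ fun i => hW.measurable _ (by omega)
      exact congrFun (IndepFun.charFun_map_fun_add_eq_mul
        ((hφ _ _ _ _ (n * b)).comp (hseq hZ)).aemeasurable
        ((hφ _ _ _ _ (n * a)).comp (hseq hY)).aemeasurable
        (hindep.symm.comp (hφ _ _ _ _ (n * b)) (hφ _ _ _ _ (n * a)))) 1
    · congr 1
      simp only [inner_zero_right, Complex.ofReal_zero, zero_mul]
      push_cast
      ring

/-! ### Consistency of the estimators -/

lemma IsAuxiliaryProcess.ae_tendsto_empVar (hY : IsAuxiliaryProcess P Y) {h : ℕ} (hh : 0 < h)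
    (a : ℕ) : ∀ᵐ ω ∂P, Tendsto
      (fun n => empVar h n (Finset.Ioc (n * a) (n * (a + h))) (Y · ω)) atTop
      (nhds (popVar P Y)) := by
  filter_upwards [hY.ae_tendsto_winMoment hh a (k := 1) (by norm_num),
    hY.ae_tendsto_winMoment hh a (k := 2) (by norm_num)] with ω h1 h2
  rw [hY.popCenteredMoment_one] at h1
  rw [hY.popCenteredMoment_two] at h2
  have hlim := h2.sub (h1.pow 2)
  rw [show popVar P Y - 0 ^ 2 = popVar P Y by ring] at hlim
  refine hlim.congr' ?_
  filter_upwards [eventually_gt_atTop 0] with n hn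
  rw [empVar_eq_winMoment a (popMean P Y) _ (Nat.mul_pos hn hh)]

lemma IsAuxiliaryProcess.ae_tendsto_empNuSq (hY : IsAuxiliaryProcess P Y) {h : ℕ} (hh : 0 < h)
    (a : ℕ) : ∀ᵐ ω ∂P, Tendsto
      (fun n => empNuSq h n (Finset.Ioc (n * a) (n * (a + h))) (Y · ω)) atTop
      (nhds (popNuSq P Y)) := by
  filter_upwards [hY.ae_tendsto_winMoment hh a (k := 1) (by norm_num),
    hY.ae_tendsto_winMoment hh a (k := 2) (by norm_num),
    hY.ae_tendsto_winMoment hh a (k := 3) (by norm_num),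
    hY.ae_tendsto_winMoment hh a (k := 4) (by norm_num)] with ω h1 h2 h3 h4
  rw [hY.popCenteredMoment_one] at h1
  rw [hY.popCenteredMoment_two] at h2
  have hlim := ((((h4.sub ((h1.const_mul 4).mul h3)).add
    (((h1.pow 2).const_mul 6).mul h2)).sub ((h1.pow 4).const_mul 3))).sub
      ((h2.sub (h1.pow 2)).pow 2)
  have e : popCenteredMoment P Y 4 - 4 * 0 * popCenteredMoment P Y 3 + 6 * 0 ^ 2 * popVar P Y
      - 3 * 0 ^ 4 - (popVar P Y - 0 ^ 2) ^ 2 = popNuSq P Y := by rw [hY.popNuSq_eq]; ring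
  rw [e] at hlim
  refine hlim.congr' ?_
  filter_upwards [eventually_gt_atTop 0] with n hn
  rw [empNuSq_eq_winMoment a (popMean P Y) _ (Nat.mul_pos hn hh)]

lemma tendstoInMeasure_correction (hY : IsAuxiliaryProcess P Y) (hZ : IsAuxiliaryProcess P Z)
    (hσ : 0 < popVar P Z + popVar P Y) (hν : 0 < popNuSq P Z + popNuSq P Y)
    {h : ℕ} (hh : 0 < h) (a b : ℕ) :
    TendstoInMeasure P (correction P Y Z h a b) atTop (fun _ => (1, 1, 0)) := by
  refine tendstoInMeasure_of_tendsto_ae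
    (fun n => (measurable_correction hY hZ h a b n).aestronglyMeasurable) ?_
  have hσ' : √(popVar P Z + popVar P Y) ≠ 0 := (Real.sqrt_pos.2 hσ).ne'
  have hν' : √(popNuSq P Z + popNuSq P Y) ≠ 0 := (Real.sqrt_pos.2 hν).ne'
  filter_upwards [hY.ae_tendsto_empVar hh a, hZ.ae_tendsto_empVar hh b,
    hY.ae_tendsto_empNuSq hh a, hZ.ae_tendsto_empNuSq hh b,
    hY.ae_tendsto_winMoment hh a (k := 1) (by norm_num),
    hZ.ae_tendsto_winMoment hh b (k := 1) (by norm_num)] with ω y2 z2 y4 z4 y1 z1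
  rw [hY.popCenteredMoment_one] at y1
  rw [hZ.popCenteredMoment_one] at z1
  have l1 := (tendsto_const_nhds (x := √(popVar P Z + popVar P Y))).div (z2.add y2).sqrt hσ'
  have l2 := (tendsto_const_nhds (x := √(popNuSq P Z + popNuSq P Y))).div (z4.add y4).sqrt hν'
  have l3 := ((tendsto_const_nhds (x := √(popVar P Z + popVar P Y))).div
    (z4.add y4).sqrt hν').mul (z1.add y1)
  rw [div_self hσ'] at l1
  rw [div_self hν'] at l2
  rw [add_zero, mul_zero] at l3
  exact l1.prodMk_nhds (l2.prodMk_nhds l3)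

end TwoSided

end

end ChangePoint

open ChangePoint
theorem lemma2 {Ω : Type*} [MeasurableSpace Ω] (P : Measure Ω) [IsProbabilityMeasure P]
    (T m : ℕ) (c : Fin m → ℕ) (X : Fin (m + 1) → ℕ → Ω → ℝ) (hX : IsModel P T c X)
    -- the window size
    (h : ℕ) (hh : h ∈ Finset.Icc 2 (T / 2))
    -- the change point `c u`, with no other change point in `(c u - h, c u + h]`
    (u : Fin m) (hu : h ≤ c u ∧ c u + h ≤ T)
    (hfree : ∀ v : Fin m, (c v : ℤ) ∈ Set.Ioc ((c u : ℤ) - h) ((c u : ℤ) + h) → v = u)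
    -- non-degeneracy: `ν²` does not vanish on both sides of the change point
    (hν : 0 < popNuSq P (X u.castSucc) + popNuSq P (X u.succ)) :
    (gammaC P (X u.castSucc) (X u.succ)).PosSemidef ∧
    TendstoInDistribution
      (fun (n : ℕ) (ω : Ω) => WithLp.toLp 2
        (statJ h n (c u) (fun i => compound c X n i ω) -
          scaling P (X u.castSucc) (X u.succ) h n (c u) (fun i => compound c X n i ω) *ᵥ
            centering P (X u.castSucc) (X u.succ) h n))
      atTop (id : EuclideanSpace ℝ (Fin 2) → EuclideanSpace ℝ (Fin 2)) (fun _ => P)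
      (multivariateGaussian 0 (gammaC P (X u.castSucc) (X u.succ))) := by
  have hh0 : 0 < h := by rw [Finset.mem_Icc] at hh; omega
  have hY := hX.auxiliary u.castSucc
  have hZ := hX.auxiliary u.succ
  have hσ : 0 < popVar P (X u.succ) + popVar P (X u.castSucc) :=
    add_pos hZ.variance_pos hY.variance_pos
  rw [add_comm] at hν
  refine ⟨posSemidef_gammaC hY hZ hσ hν, ?_⟩
  have hindep : IndepFun (fun ω (i : ℕ) => X u.castSucc (i + 1) ω)
      (fun ω (i : ℕ) => X u.succ (i + 1) ω) P :=
    hX.indep.indepFun (Fin.castSucc_lt_succ (i := u)).ne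
  obtain ⟨a, ha⟩ : ∃ a, c u = a + h := ⟨c u - h, (Nat.sub_add_cancel hu.1).symm⟩
  have hlim := (tendstoInDistribution_normalizedDiff hY hZ hindep hσ hν hh0 a
    (a + h)).continuous_comp_prodMk_of_tendstoInMeasure_const continuous_applyCorrection
    (tendstoInMeasure_correction hY hZ hσ hν hh0 a (a + h))
    fun n => (measurable_correction hY hZ h a (a + h) n).aemeasurable
  convert! hlim using 1
  · funext n ω
    have hleft : ∀ i ∈ Finset.Ioc (n * a) (n * (a + h)),
        compound c X n i ω = X u.castSucc i ω := fun i hi => by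
      rw [compound, segment_eq_castSucc hX.strictMono ha hfree hi]
    have hright : ∀ i ∈ Finset.Ioc (n * (a + h)) (n * (a + h + h)),
        compound c X n i ω = X u.succ i ω := fun i hi => by
      rw [← ha] at hi
      rw [compound, segment_eq_succ hX.strictMono hfree hi]
    rw [ha]
    exact statJ_sub_scaling_mulVec_centering P _ _ h a n ω _ hleft hright hσ hν
  · funext z
    exact (applyCorrection_one_one_zero z).symm
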